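/- Throughout, fix an o-minimal structure (containing all real algebraic sets) and a field $F$. For a compact definable set $M\subset\mathbb R^d$, a unit vector $v\in S^{d-1}$ and $t\in\mathbb R$ put $M_{v,t}=\{x\in M:\langle v,x\rangle\le t\}$. The Euler curve of $M$ in direction $v$ is $\operatorname{ECT}(M,v)\colon t\mapsto\chi(M_{v,t})$, where $\chi$ is the definable Euler characteristic: $\chi(S)=\sum_i(-1)^{\dim\sigma_i}$ for any definable bijection of $S$ with a finite disjoint union of open simplices $\sigma_i$. The degree-$k$ persistence diagram $PH_k(M,h_v)$ is the finite multiset of points $(b,d)$, $b<d$, of the extended plane such that for all real $s\le t$ the rank of $H_k(M_{v,s};F)\to H_k(M_{v,t};F)$ (singular homology, map induced by inclusion) is the number, with multiplicity, of its points in $[-\infty,s]\times(t,\infty]$. For a finite set $X\subset\mathbb R^d$ let $W(X)=\bigcup_{x\neq y\in X}\{v:\langle x,v\rangle=\langle y,v\rangle\}$ and $\Sigma(X)=S^{d-1}\setminus W(X)$. Let $X\subset\mathbb R^d$ be finite and let $v,w$ lie in the same connected component of $\Sigma(X)$. Then there is an order-preserving bijection $\varphi\colon\mathbb R\to\mathbb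 R$ with $\varphi(\langle v,x\rangle)=\langle w,x\rangle$ for all $x\in X$, and for every such $\varphi$ and every finite geometric simplicial complex $K\subset\mathbb R^d$ with vertex set $X$ (identified with its underlying set) the following hold. 1. $\operatorname{ECT}(K,w)=\operatorname{ECT}(K,v)\circ\varphi^{-1}$. More precisely, for every $t\in\mathbb R$ and $m\in\mathbb Z$, the set $K_{w,\varphi(t)}$ admits a definable bijection onto a finite disjoint union of open simplices with $\sum_i(-1)^{\dim\sigma_i}=m$ if and only if $K_{v,t}$ does. 2. For every $k\ge 0$, if $D$ is the degree-$k$ persistence diagram of $K$ in direction $v$, then the image multiset $(\varphi,\varphi)(D)$, where $\varphi(\pm\infty)=\pm\infty$, is the degree-$k$ persistence diagram of $K$ in direction $w$, and it is the only multiset with the defining property of that diagram. -/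

import Mathlib

open Set CategoryTheory
open scoped RealInnerProductSpace

universe u

noncomputable section

/-! ### O-minimal structures and the definable Euler characteristic -/

/-- An o-minimal structure (expanding the real field): for every `n` a collection of subsets of
`ℝⁿ`, closed under intersection and complement, under `A ↦ A × ℝ`, `A ↦ ℝ × A` and under
axis-aligned projections `ℝⁿ⁺¹ → ℝⁿ`, containing all real algebraic sets, and whose members in
`ℝ¹` are exactly the finite unions of points and (possibly unbounded) open intervals. -/
structure OMinimalStructure where
  /-- the definable subsets of `ℝⁿ` -/
  sets : (n : ℕ) → Set (Set (Fin n → ℝ))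
  inter_mem : ∀ {n : ℕ} {A B : Set (Fin n → ℝ)}, A ∈ sets n → B ∈ sets n → A ∩ B ∈ sets n
  compl_mem : ∀ {n : ℕ} {A : Set (Fin n → ℝ)}, A ∈ sets n → Aᶜ ∈ sets n
  prod_univ_mem : ∀ {n : ℕ} {A : Set (Fin n → ℝ)}, A ∈ sets n →
    {x : Fin (n + 1) → ℝ | Fin.init x ∈ A} ∈ sets (n + 1)
  univ_prod_mem : ∀ {n : ℕ} {A : Set (Fin n → ℝ)}, A ∈ sets n →
    {x : Fin (n + 1) → ℝ | Fin.tail x ∈ A} ∈ sets (n + 1)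
  proj_mem : ∀ {n : ℕ} {A : Set (Fin (n + 1) → ℝ)} (i : Fin (n + 1)), A ∈ sets (n + 1) →
    (fun x : Fin (n + 1) → ℝ => i.removeNth x) '' A ∈ sets n
  algebraic_mem : ∀ {n : ℕ} (P : Set (MvPolynomial (Fin n) ℝ)),
    {x : Fin n → ℝ | ∀ p ∈ P, MvPolynomial.eval x p = 0} ∈ sets n
  one_dim : ∀ A : Set (Fin 1 → ℝ), A ∈ sets 1 ↔
    ∃ C : Set (Set ℝ), C.Finite ∧
      (∀ I ∈ C, (∃ a : ℝ, I = {a}) ∨ ∃ a b : EReal, I = {x : ℝ | a < (x : EReal) ∧ (x : EReal) < b}) ∧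
      A = {x : Fin 1 → ℝ | x 0 ∈ ⋃₀ C}

/-- The open simplex with vertex set `σ`: all convex combinations of the points of `σ` with
strictly positive coefficients. -/
def openSimplex {N : ℕ} (σ : Finset (Fin N → ℝ)) : Set (Fin N → ℝ) :=
  {y | ∃ a : (Fin N → ℝ) → ℝ, (∀ x ∈ σ, 0 < a x) ∧ ∑ x ∈ σ, a x = 1 ∧ ∑ x ∈ σ, a x • x = y}

/-- `h` restricts to a bijection `S → T` whose graph is definable. -/
def OMinimalStructure.IsDefinableBijection (O : OMinimalStructure) {n N : ℕ}
    (h : (Fin n → ℝ) → (Fin N → ℝ)) (S : Set (Fin n → ℝ)) (T : Set (Fin N → ℝ)) : Prop :=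
  BijOn h S T ∧ {p : Fin (n + N) → ℝ | ∃ x ∈ S, p = Fin.append x (h x)} ∈ O.sets (n + N)

/-- `m` is a value of the definable Euler characteristic of `S`: there is a definable bijection of
`S` onto the union of a finite collection `C` of pairwise disjoint open simplices in some `ℝᴺ`, and
`m = ∑ (-1) ^ dim σ` over `σ ∈ C`. -/
def OMinimalStructure.IsEulerChar (O : OMinimalStructure) {n : ℕ}
    (S : Set (Fin n → ℝ)) (m : ℤ) : Prop :=
  ∃ (N : ℕ) (C : Finset (Finset (Fin N → ℝ))) (h : (Fin n → ℝ) → (Fin N → ℝ)),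
    (∀ σ ∈ C, σ.Nonempty ∧ AffineIndependent ℝ ((↑) : σ → (Fin N → ℝ))) ∧
    (C : Set (Finset (Fin N → ℝ))).PairwiseDisjoint openSimplex ∧
    O.IsDefinableBijection h S (⋃ σ ∈ C, openSimplex σ) ∧
    m = ∑ σ ∈ C, (-1 : ℤ) ^ (σ.card - 1)

open Classical in
/-- The definable Euler characteristic of a definable set. -/
def OMinimalStructure.eulerChar (O : OMinimalStructure) {n : ℕ} (S : Set (Fin n → ℝ)) : ℤ :=
  if h : ∃ m, O.IsEulerChar S m then h.choose else 0

/-! ### Sublevel sets of height functions and Euler curves -/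

/-- The sublevel set `M_{v,t} = {x ∈ M | ⟨v, x⟩ ≤ t}` of the height function in direction `v`. -/
def sublevel {d : ℕ} (M : Set (EuclideanSpace ℝ (Fin d))) (v : EuclideanSpace ℝ (Fin d)) (t : ℝ) :
    Set (EuclideanSpace ℝ (Fin d)) :=
  {x | x ∈ M ∧ ⟪v, x⟫ ≤ t}

/-- `M_{v,t}` as a set of coordinate tuples. -/
def sublevelCoord {d : ℕ} (M : Set (EuclideanSpace ℝ (Fin d))) (v : EuclideanSpace ℝ (Fin d))
    (t : ℝ) : Set (Fin d → ℝ) :=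
  WithLp.ofLp '' sublevel M v t

/-- The Euler curve of `M` in direction `v`, that is `t ↦ χ(M_{v,t})`. -/
def eulerCurve (O : OMinimalStructure) {d : ℕ} (M : Set (EuclideanSpace ℝ (Fin d)))
    (v : EuclideanSpace ℝ (Fin d)) (t : ℝ) : ℤ :=
  O.eulerChar (sublevelCoord M v t)

/-! ### Sublevel set persistent homology and persistence diagrams -/

theorem sublevel_mono {d : ℕ} (M : Set (EuclideanSpace ℝ (Fin d))) (v : EuclideanSpace ℝ (Fin d))
    {s t : ℝ} (h : s ≤ t) : sublevel M v s ⊆ sublevel M v t :=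
  fun _ hx => ⟨hx.1, hx.2.trans h⟩

/-- The inclusion `M_{v,s} → M_{v,t}` for `s ≤ t`, as a continuous map. -/
def sublevelIncl {d : ℕ} (M : Set (EuclideanSpace ℝ (Fin d))) (v : EuclideanSpace ℝ (Fin d))
    {s t : ℝ} (h : s ≤ t) : TopCat.of (sublevel M v s) ⟶ TopCat.of (sublevel M v t) :=
  TopCat.ofHom ⟨inclusion (sublevel_mono M v h), continuous_inclusion (sublevel_mono M v h)⟩

/-- The map `H_k(M_{v,s}; F) → H_k(M_{v,t}; F)` induced by inclusion on singular homology. -/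
def persistenceMap (F : Type u) [Field F] {d : ℕ} (M : Set (EuclideanSpace ℝ (Fin d)))
    (v : EuclideanSpace ℝ (Fin d)) (k : ℕ) {s t : ℝ} (h : s ≤ t) :=
  (((AlgebraicTopology.singularHomologyFunctor (ModuleCat.{u} F) k).obj (ModuleCat.of F F)).map
    (sublevelIncl M v h)).hom

open Classical in
/-- `D` is the degree-`k` persistence diagram of `M` filtered by the height function in direction
`v`: a finite multiset of points `(b, d)` of the extended plane with `b < d` (so that `b ≠ ∞` and
`d ≠ -∞`) such that, for all real `s ≤ t`, the rank of `H_k(M_{v,s}) → H_k(M_{v,t})` is the number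
of points of `D` in `[-∞, s] × (t, ∞]`, counted with multiplicity. -/
def IsPersistenceDiagram (F : Type u) [Field F] {d : ℕ} (M : Set (EuclideanSpace ℝ (Fin d)))
    (v : EuclideanSpace ℝ (Fin d)) (k : ℕ) (D : Multiset (EReal × EReal)) : Prop :=
  (∀ p ∈ D, p.1 < p.2) ∧
  ∀ (s t : ℝ) (h : s ≤ t), (persistenceMap F M v k h).rank =
    ((D.filter fun p => p.1 ≤ (s : EReal) ∧ (t : EReal) < p.2).card : Cardinal)

/-- The extension of `φ : ℝ → ℝ` to the extended reals that fixes `-∞` and `∞`. -/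
def extendEReal (φ : ℝ → ℝ) : EReal → EReal := WithBot.map (WithTop.map φ)

/-! ### The hyperplane division of the sphere -/

/-- `W(X)`: the union, over all pairs of distinct points `x, y` of `X`, of the hyperplanes
`{v | ⟨x, v⟩ = ⟨y, v⟩}`. -/
def hyperplaneUnion {d : ℕ} (X : Set (EuclideanSpace ℝ (Fin d))) :
    Set (EuclideanSpace ℝ (Fin d)) :=
  {v | ∃ x ∈ X, ∃ y ∈ X, x ≠ y ∧ ⟪x, v⟫ = ⟪y, v⟫}

/-- `Σ(X)`: the complement of `W(X)` in the unit sphere. -/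
def sphereComplement {d : ℕ} (X : Set (EuclideanSpace ℝ (Fin d))) :
    Set (EuclideanSpace ℝ (Fin d)) :=
  Metric.sphere 0 1 \ hyperplaneUnion X

/-- `v` and `w` are points of `Σ(X)` in the same connected component (stratum, chamber). -/
def SameChamber {d : ℕ} (X : Set (EuclideanSpace ℝ (Fin d)))
    (v w : EuclideanSpace ℝ (Fin d)) : Prop :=
  v ∈ sphereComplement X ∧ w ∈ connectedComponentIn (sphereComplement X) v

end

/-! Fix a level `t` and put `t' = φ t`. Since `φ` preserves order, each vertex `x` has signed
heights `⟪v, x⟫ - t` and `⟪w, x⟫ - t'` of the same sign, so positive factors `c x` turn the second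
into the first (`exists_isLevelRatio`). Multiply barycentric coordinates by `c` and renormalise.
This `rescale` maps every closed simplex to itself, has inverse `rescale c⁻¹`, and divides signed
heights by the positive mass `∑ c i * l i`. Hence it carries `K_{v,t}` homeomorphically onto
`K_{w,t'}`.

Its graph is a finite union of projections of real algebraic sets, so it is a definable bijection
and the two sublevel sets have the same Euler characteristic values.

For persistence the factors depend on the level, so the homeomorphisms do not commute with the
inclusions. But all of them preserve simplices, so going through the `v`-filtration and back is
homotopic to the `w`-inclusion by straight lines inside simplices. The persistence ranks therefore
agree (`rank_persistenceMap_eq`), and ranks determine the diagram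
(`multiset_eq_of_quadrant_counts`).

The map `φ` exists because two vertices cannot exchange heights along a chamber without meeting
`W(X)`. -/

noncomputable section

/-! ### Definable sets and definable bijections -/

namespace OMinimalStructure

variable (O : OMinimalStructure)

theorem univ_mem (n : ℕ) : (univ : Set (Fin n → ℝ)) ∈ O.sets n := by
  simpa using O.algebraic_mem (n := n) ∅

theorem empty_mem (n : ℕ) : (∅ : Set (Fin n → ℝ)) ∈ O.sets n := by
  simpa using O.compl_mem (O.univ_mem n)

theorem union_mem {n : ℕ} {A B : Set (Fin n → ℝ)} (hA : A ∈ O.sets n) (hB : B ∈ O.sets n) :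
    A ∪ B ∈ O.sets n := by
  have := O.compl_mem (O.inter_mem (O.compl_mem hA) (O.compl_mem hB))
  rwa [← compl_union, compl_compl] at this

theorem biUnion_mem {n : ℕ} {ι : Type*} {s : Set ι} (hs : s.Finite) {A : ι → Set (Fin n → ℝ)}
    (hA : ∀ i ∈ s, A i ∈ O.sets n) : ⋃ i ∈ s, A i ∈ O.sets n := by
  induction s, hs using Set.Finite.induction_on with
  | empty => simpa using O.empty_mem n
  | insert _ _ ih =>
    rw [biUnion_insert]
    exact O.union_mem (hA _ (mem_insert _ _)) (ih fun i hi => hA i (mem_insert_of_mem _ hi))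

/-- Definable sets are closed under projection along the last `m` coordinates. -/
theorem exists_append_mem {n m : ℕ} {A : Set (Fin (n + m) → ℝ)} (hA : A ∈ O.sets (n + m)) :
    {x : Fin n → ℝ | ∃ y : Fin m → ℝ, Fin.append x y ∈ A} ∈ O.sets n := by
  induction m with
  | zero =>
    have h : ∀ (x : Fin n → ℝ) (y : Fin 0 → ℝ), Fin.append x y = x := fun x y => by
      rw [Subsingleton.elim y Fin.elim0, Fin.append_elim0]; rfl
    have h' : {x : Fin n → ℝ | ∃ y : Fin 0 → ℝ, Fin.append x y ∈ A} = A := by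
      refine Set.ext fun x => ?_
      simp only [mem_ofPred_eq, h, exists_const]
    rw [h']
    exact hA
  | succ m ih =>
    convert ih (O.proj_mem (n := n + m) (Fin.last _) hA) using 1
    ext x
    simp only [mem_ofPred_eq, mem_image, Fin.removeNth_last]
    constructor
    · rintro ⟨y, hy⟩
      refine ⟨Fin.init y, _, hy, ?_⟩
      rw [← Fin.snoc_init_self y, Fin.append_snoc]
      simp
    · rintro ⟨y, z, hz, h⟩
      refine ⟨Fin.snoc y (z (Fin.last _)), ?_⟩
      rw [Fin.append_snoc, ← h]
      simpa using hz

theorem addNat_mem {m : ℕ} {A : Set (Fin m → ℝ)} (hA : A ∈ O.sets m) (j : ℕ) :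
    {z : Fin (m + j) → ℝ | (fun i => z (Fin.addNat i j)) ∈ A} ∈ O.sets (m + j) := by
  induction j with
  | zero => exact hA
  | succ j ih => exact O.univ_prod_mem ih

theorem cast_mem {m n : ℕ} {A : Set (Fin m → ℝ)} (hA : A ∈ O.sets m) (h : m = n) :
    {z : Fin n → ℝ | (fun i => z (Fin.cast h i)) ∈ A} ∈ O.sets n := by
  subst h
  exact hA

theorem natAdd_mem {m : ℕ} {A : Set (Fin m → ℝ)} (hA : A ∈ O.sets m) (n : ℕ) :
    {z : Fin (n + m) → ℝ | (fun i => z (Fin.natAdd n i)) ∈ A} ∈ O.sets (n + m) := by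
  convert O.cast_mem (O.addNat_mem hA n) (add_comm m n) using 1
  ext z
  have : ∀ i : Fin m, Fin.natAdd n i = Fin.cast (add_comm m n) (Fin.addNat i n) := fun i =>
    Fin.ext (add_comm _ _)
  simp only [mem_ofPred_eq, this]

/-- Preimages of definable sets under reindexing of coordinates are definable. -/
theorem preimage_reindex_mem {m n : ℕ} {A : Set (Fin m → ℝ)} (hA : A ∈ O.sets m)
    (e : Fin m → Fin n) : {x : Fin n → ℝ | x ∘ e ∈ A} ∈ O.sets n := by
  -- Adjoin new coordinates `y`, impose `y ∈ A` and the linear equations `y = x ∘ e`, then project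
  -- `y` away.
  have h := O.exists_append_mem (O.inter_mem (O.natAdd_mem hA n) (O.algebraic_mem (range fun i =>
    (MvPolynomial.X (Fin.natAdd n i) - MvPolynomial.X (Fin.castAdd m (e i)) :
      MvPolynomial (Fin (n + m)) ℝ))))
  convert h using 1
  ext x
  simp only [mem_ofPred_eq, mem_inter_iff, Fin.append_right, forall_mem_range, map_sub,
    MvPolynomial.eval_X, Fin.append_left, sub_eq_zero]
  constructor
  · exact fun hx => ⟨x ∘ e, hx, fun _ => rfl⟩
  · rintro ⟨y, hy, h⟩
    have : y = x ∘ e := funext h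
    exact this ▸ hy

/-- A projection of a real algebraic set is definable. -/
theorem exists_eval_eq_zero_mem {n : ℕ} {κ : Type*} [Finite κ]
    (P : Set (MvPolynomial (Fin n ⊕ κ) ℝ)) :
    {x : Fin n → ℝ | ∃ y : κ → ℝ, ∀ p ∈ P, MvPolynomial.eval (Sum.elim x y) p = 0} ∈ O.sets n := by
  obtain ⟨m, ⟨e⟩⟩ := Finite.exists_equiv_fin κ
  convert O.exists_append_mem (m := m) (O.algebraic_mem
    (MvPolynomial.rename (Sum.elim (Fin.castAdd m) (Fin.natAdd n ∘ e)) '' P)) using 1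
  ext x
  simp only [mem_ofPred_eq, forall_mem_image, MvPolynomial.eval_rename]
  constructor
  · rintro ⟨y, h⟩
    refine ⟨y ∘ e.symm, fun p hp => ?_⟩
    convert h p hp using 2
    congr 1
    ext (i | i) <;> simp
  · rintro ⟨y, h⟩
    refine ⟨y ∘ e, fun p hp => ?_⟩
    convert h hp using 2
    congr 1
    ext (i | i) <;> simp

variable {O}

/-- The graph is the projection of the triples `(x, z, y)` with `y = f x` and `z = g y`; the
intermediate point stands last so that `exists_append_mem` eliminates it. -/
theorem IsDefinableBijection.comp {n m k : ℕ} {g : (Fin m → ℝ) → (Fin k → ℝ)}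
    {f : (Fin n → ℝ) → (Fin m → ℝ)} {S : Set (Fin n → ℝ)} {T : Set (Fin m → ℝ)}
    {U : Set (Fin k → ℝ)} (hg : O.IsDefinableBijection g T U) (hf : O.IsDefinableBijection f S T) :
    O.IsDefinableBijection (g ∘ f) S U := by
  refine ⟨hg.1.comp hf.1, ?_⟩
  convert O.exists_append_mem (O.inter_mem
    (O.preimage_reindex_mem hf.2
      (Fin.append (Fin.castAdd m ∘ Fin.castAdd k) (Fin.natAdd (n + k))))
    (O.preimage_reindex_mem hg.2
      (Fin.append (Fin.natAdd (n + k)) (Fin.castAdd m ∘ Fin.natAdd n)))) using 1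
  ext p
  have key : ∀ {a b c : ℕ} (z : Fin c → ℝ) (e₁ : Fin a → Fin c) (e₂ : Fin b → Fin c) (x y),
      z ∘ Fin.append e₁ e₂ = Fin.append x y ↔ z ∘ e₁ = x ∧ z ∘ e₂ = y := by
    intro a b c z e₁ e₂ x y
    constructor
    · intro h
      exact ⟨funext fun i => by simpa using congrFun h (Fin.castAdd b i),
        funext fun i => by simpa using congrFun h (Fin.natAdd a i)⟩
    · rintro ⟨rfl, rfl⟩
      ext i
      refine Fin.addCases (fun i => ?_) (fun i => ?_) i <;> simp
  simp only [mem_ofPred_eq, mem_inter_iff, key]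
  constructor
  · rintro ⟨x, hx, rfl⟩
    refine ⟨f x, ⟨x, hx, ?_, ?_⟩, f x, hf.1.mapsTo hx, ?_, ?_⟩ <;> ext i <;> simp
  · rintro ⟨y, ⟨x, hx, h₁, h₂⟩, x', hx', h₃, h₄⟩
    refine ⟨x, hx, ?_⟩
    obtain rfl : y = x' := by rw [← h₃]; ext i; simp
    obtain rfl : y = f x := by rw [← h₂]; ext i; simp
    ext i
    refine Fin.addCases (fun i => ?_) (fun i => ?_) i
    · simpa using congrFun h₁ i
    · simpa using congrFun h₄ i

theorem IsDefinableBijection.isEulerChar {n k : ℕ} {f : (Fin n → ℝ) → (Fin k → ℝ)}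
    {S : Set (Fin n → ℝ)} {T : Set (Fin k → ℝ)} (hf : O.IsDefinableBijection f S T) {m : ℤ}
    (hm : O.IsEulerChar T m) : O.IsEulerChar S m := by
  obtain ⟨N, C, h, hC, hd, hh, rfl⟩ := hm
  exact ⟨N, C, h ∘ f, hC, hd, hh.comp hf, rfl⟩

/-- Both sides are choices from the same predicate, so it does not matter here whether a set has
only one Euler characteristic value. -/
theorem eulerChar_congr {n k : ℕ} {S : Set (Fin n → ℝ)} {T : Set (Fin k → ℝ)}
    (h : ∀ m, O.IsEulerChar S m ↔ O.IsEulerChar T m) : O.eulerChar S = O.eulerChar T := by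
  have : O.IsEulerChar S = O.IsEulerChar T := funext fun m => propext (h m)
  unfold eulerChar
  rw [this]

end OMinimalStructure

/-! ### Barycentric weights and their rescaling -/

theorem IsCompact.continuousOn_invFunOn {α β : Type*} [TopologicalSpace α] [TopologicalSpace β]
    [T2Space β] [Nonempty α] {A : Set α} {f : α → β} (hA : IsCompact A) (hf : ContinuousOn f A)
    (hinj : InjOn f A) : ContinuousOn (Function.invFunOn f A) (f '' A) := by
  rw [continuousOn_iff_isClosed]
  intro t ht
  refine ⟨f '' (A ∩ t), ((hA.inter_right ht).image_of_continuousOn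
    (hf.mono inter_subset_left)).isClosed, ?_⟩
  ext y
  constructor
  · rintro ⟨hy, a, ha, rfl⟩
    rw [mem_preimage, hinj.leftInvOn_invFunOn ha] at hy
    exact ⟨⟨a, ⟨ha, hy⟩, rfl⟩, a, ha, rfl⟩
  · rintro ⟨⟨a, ⟨ha, hat⟩, rfl⟩, -⟩
    refine ⟨?_, a, ha, rfl⟩
    rwa [mem_preimage, hinj.leftInvOn_invFunOn ha]

section Reweight

variable {ι : Type*} [Fintype ι]

theorem mass_pos {c l : ι → ℝ} (hc : ∀ i, 0 < c i) (hl : l ∈ stdSimplex ℝ ι) :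
    0 < ∑ i, c i * l i := by
  obtain ⟨j, -, hj⟩ : ∃ j ∈ Finset.univ, l j ≠ 0 :=
    Finset.exists_ne_zero_of_sum_ne_zero (by rw [hl.2]; exact one_ne_zero)
  exact Finset.sum_pos' (fun i _ => mul_nonneg (hc i).le (hl.1 i))
    ⟨j, Finset.mem_univ _, mul_pos (hc j) ((hl.1 j).lt_of_ne' hj)⟩

/-- The weights proportional to `c i * l i`. -/
def reweight (c l : ι → ℝ) : ι → ℝ := fun i => c i * l i / ∑ j, c j * l j

/-- Normalising only changes a common scalar factor, and the condition of total weight one restores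
it. -/
theorem reweight_inv_reweight {c l : ι → ℝ} (hc : ∀ i, 0 < c i) (hl : l ∈ stdSimplex ℝ ι) :
    reweight (c⁻¹) (reweight c l) = l := by
  have hm := (mass_pos hc hl).ne'
  have h : ∀ i, (c⁻¹) i * reweight c l i = l i / ∑ j, c j * l j := fun i => by
    simp only [reweight, Pi.inv_apply]
    rw [← mul_div_assoc, inv_mul_cancel_left₀ (hc i).ne']
  ext i
  change (c⁻¹) i * reweight c l i / ∑ j, (c⁻¹) j * reweight c l j = l i
  simp only [h]
  rw [← Finset.sum_div, hl.2, div_div, mul_one_div, div_self hm, div_one]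

theorem continuousOn_reweight {c : ι → ℝ} (hc : ∀ i, 0 < c i) :
    ContinuousOn (reweight c) (stdSimplex ℝ ι) := by
  refine continuousOn_pi.2 fun i => ContinuousOn.div (by fun_prop) (by fun_prop) fun l hl => ?_
  exact (mass_pos hc hl).ne'

end Reweight

section FaceWeights

variable {E : Type*} {X : Finset E}

/-- The barycentric weights on `X` that are supported on `s`. -/
def faceWeights (X : Finset E) (s : Finset E) : Set (X → ℝ) :=
  {l | l ∈ stdSimplex ℝ X ∧ ∀ i : X, (i : E) ∉ s → l i = 0}

theorem isCompact_faceWeights (X s : Finset E) : IsCompact (faceWeights X s) := by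
  refine (isCompact_stdSimplex ℝ X).inter_right (t := {l | ∀ i : X, (i : E) ∉ s → l i = 0}) ?_
  simp only [ofPred_forall]
  exact isClosed_iInter fun i => isClosed_iInter fun _ =>
    isClosed_eq (continuous_apply i) continuous_const

theorem reweight_mem_faceWeights {c l : X → ℝ} {s : Finset E} (hc : ∀ i, 0 < c i)
    (hl : l ∈ faceWeights X s) : reweight c l ∈ faceWeights X s := by
  have hm := mass_pos hc hl.1
  refine ⟨⟨fun i => div_nonneg (mul_nonneg (hc i).le (hl.1.1 i)) hm.le, ?_⟩, fun i hi => ?_⟩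
  · simp only [reweight]
    rw [← Finset.sum_div, div_self hm.ne']
  · simp [reweight, hl.2 i hi]

theorem sum_face_eq_sum {M : Type*} [AddCommMonoid M] {s : Finset E} (hs : s ⊆ X) (g : X → M)
    (hg : ∀ i : X, (i : E) ∉ s → g i = 0) : ∑ e : s, g ⟨e, hs e.2⟩ = ∑ i, g i := by
  refine Finset.sum_of_injOn (fun e : s => (⟨e, hs e.2⟩ : X)) ?_ (by simp [MapsTo]) ?_
    (fun _ _ => rfl)
  · intro a _ b _ hab
    exact Subtype.ext (congrArg (fun x : X => (x : E)) hab)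
  · intro i _ hi
    exact hg i fun his => hi ⟨⟨i, his⟩, by simp, rfl⟩

end FaceWeights

section Weights

variable {E : Type*} [AddCommGroup E] [Module ℝ E] {X : Finset E}

/-- The combination of the points of `X` with the given weights. -/
def weightedSum (l : X → ℝ) : E := ∑ i, l i • (i : E)

theorem weightedSum_image_faceWeights {s : Finset E} (hs : s ⊆ X) :
    weightedSum '' faceWeights X s = convexHull ℝ (s : Set E) := by
  classical
  ext p
  constructor
  · rintro ⟨l, ⟨⟨h₀, h₁⟩, hl⟩, rfl⟩
    unfold weightedSum
    rw [← Finset.sum_filter_of_ne (p := fun i : X => (i : E) ∈ s)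
      (fun i _ hi => by by_contra h; exact hi (by rw [hl i h, zero_smul]))]
    refine (convex_convexHull ℝ _).sum_mem (fun i _ => h₀ i) ?_ (fun i hi =>
      subset_convexHull _ _ (Finset.mem_filter.1 hi).2)
    rw [Finset.sum_filter_of_ne (fun i _ hi => by by_contra h; exact hi (hl i h)), h₁]
  · intro hp
    obtain ⟨a, h₀, h₁, rfl⟩ := Finset.mem_convexHull'.1 hp
    refine ⟨fun i => if (i : E) ∈ s then a i else 0, ⟨⟨fun i => ?_, ?_⟩, fun i hi => if_neg hi⟩, ?_⟩
    · dsimp only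
      split_ifs with h
      exacts [h₀ _ h, le_rfl]
    · rw [Finset.sum_coe_sort X (fun y => if y ∈ s then a y else 0), Finset.sum_ite_mem,
        Finset.inter_eq_right.2 hs, h₁]
    · simp only [weightedSum, ite_smul, zero_smul]
      rw [Finset.sum_coe_sort X (fun y => if y ∈ s then a y • y else 0), Finset.sum_ite_mem,
        Finset.inter_eq_right.2 hs]

theorem weightedSum_injOn_faceWeights {s : Finset E} (hs : s ⊆ X)
    (hind : AffineIndependent ℝ ((↑) : s → E)) : InjOn weightedSum (faceWeights X s) := by
  rintro l ⟨hl, hls⟩ l' ⟨hl', hls'⟩ h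
  rw [affineIndependent_iff] at hind
  have h0 := hind Finset.univ (fun e => l ⟨e, hs e.2⟩ - l' ⟨e, hs e.2⟩) ?_ ?_
  · ext i
    by_cases hi : (i : E) ∈ s
    · exact sub_eq_zero.1 (h0 ⟨i, hi⟩ (Finset.mem_univ _))
    · rw [hls i hi, hls' i hi]
  · rw [sum_face_eq_sum hs (fun i => l i - l' i) fun i hi => by rw [hls i hi, hls' i hi, sub_zero],
      Finset.sum_sub_distrib, hl.2, hl'.2, sub_self]
  · refine (sum_face_eq_sum hs (fun i => (l i - l' i) • (i : E)) fun i hi => by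
      rw [hls i hi, hls' i hi, sub_zero, zero_smul]).trans ?_
    simp only [sub_smul, Finset.sum_sub_distrib]
    exact sub_eq_zero.2 h

end Weights

/-! ### The rescaling map of a simplicial complex -/

namespace Geometry.SimplicialComplex

variable {E : Type*} [AddCommGroup E] [Module ℝ E] {K : SimplicialComplex ℝ E} {X : Finset E}

theorem face_subset_of_vertices_eq (hX : K.vertices = (X : Set E)) {s : Finset E}
    (hs : s ∈ K.faces) : s ⊆ X := by
  intro x hx
  have : x ∈ K.vertices := by
    rw [vertices_eq]
    exact mem_biUnion hs hx
  rw [hX] at this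
  exact this

/-- The geometric realization of `K` in terms of barycentric weights on `X`. -/
def weights (K : SimplicialComplex ℝ E) (X : Finset E) : Set (X → ℝ) :=
  ⋃ s ∈ K.faces, faceWeights X s

theorem weights_subset_stdSimplex : K.weights X ⊆ stdSimplex ℝ X :=
  iUnion₂_subset fun _ _ _ hl => hl.1

theorem isCompact_weights (hK : K.faces.Finite) : IsCompact (K.weights X) :=
  hK.isCompact_biUnion fun s _ => isCompact_faceWeights X s

theorem weightedSum_image_weights (hX : K.vertices = (X : Set E)) :
    weightedSum '' K.weights X = K.space := by
  rw [weights, image_iUnion₂]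
  exact iUnion₂_congr fun s hs =>
    weightedSum_image_faceWeights (face_subset_of_vertices_eq hX hs)

/-- A point of two faces `s` and `t` lies in the hull of `s ∩ t`, so it has weights supported there.
Affine independence of `s` and of `t` identifies these with both given weights. -/
theorem weightedSum_injOn_weights (hX : K.vertices = (X : Set E)) :
    InjOn weightedSum (K.weights X) := by
  classical
  intro l hl l' hl' h
  obtain ⟨s, hs, hls⟩ := mem_iUnion₂.1 hl
  obtain ⟨t, ht, hlt⟩ := mem_iUnion₂.1 hl'
  have hsX := face_subset_of_vertices_eq hX hs
  have htX := face_subset_of_vertices_eq hX ht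
  have h₁ : weightedSum l ∈ convexHull ℝ ((s ∩ t : Finset E) : Set E) := by
    rw [Finset.coe_inter]
    refine K.inter_subset_convexHull hs ht ⟨?_, ?_⟩
    · exact weightedSum_image_faceWeights hsX ▸ mem_image_of_mem _ hls
    · exact h ▸ weightedSum_image_faceWeights htX ▸ mem_image_of_mem _ hlt
  rw [← weightedSum_image_faceWeights (Finset.inter_subset_left.trans hsX)] at h₁
  obtain ⟨m, hm, hml⟩ := h₁
  have e₁ : m = l := weightedSum_injOn_faceWeights hsX (K.indep hs)
    ⟨hm.1, fun i hi => hm.2 i fun h => hi (Finset.mem_inter.1 h).1⟩ hls hml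
  have e₂ : m = l' := weightedSum_injOn_faceWeights htX (K.indep ht)
    ⟨hm.1, fun i hi => hm.2 i fun h => hi (Finset.mem_inter.1 h).2⟩ hlt (hml.trans h)
  exact e₁.symm.trans e₂

/-- The map of the underlying space of `K` which is, on each simplex, the projective map that
fixes the vertices and multiplies the homogeneous barycentric coordinates by `c`. -/
def rescale (K : SimplicialComplex ℝ E) (c : X → ℝ) (p : E) : E :=
  weightedSum (reweight c (Function.invFunOn weightedSum (K.weights X) p))

theorem rescale_weightedSum (hX : K.vertices = (X : Set E)) (c : X → ℝ) {l : X → ℝ}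
    (hl : l ∈ K.weights X) : K.rescale c (weightedSum l) = weightedSum (reweight c l) := by
  rw [rescale, (weightedSum_injOn_weights hX).leftInvOn_invFunOn hl]

theorem rescale_mem_convexHull (hX : K.vertices = (X : Set E)) {c : X → ℝ} (hc : ∀ i, 0 < c i)
    {s : Finset E} (hs : s ∈ K.faces) {p : E} (hp : p ∈ convexHull ℝ (s : Set E)) :
    K.rescale c p ∈ convexHull ℝ (s : Set E) := by
  rw [← weightedSum_image_faceWeights (face_subset_of_vertices_eq hX hs)] at hp ⊢
  obtain ⟨l, hl, rfl⟩ := hp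
  rw [rescale_weightedSum hX c (mem_biUnion hs hl)]
  exact mem_image_of_mem _ (reweight_mem_faceWeights hc hl)

theorem rescale_inv_rescale (hX : K.vertices = (X : Set E)) {c : X → ℝ} (hc : ∀ i, 0 < c i)
    {p : E} (hp : p ∈ K.space) : K.rescale c⁻¹ (K.rescale c p) = p := by
  rw [← weightedSum_image_weights hX] at hp
  obtain ⟨l, hl, rfl⟩ := hp
  obtain ⟨s, hs, hls⟩ := mem_iUnion₂.1 hl
  rw [rescale_weightedSum hX c hl, rescale_weightedSum hX _
    (mem_biUnion hs (reweight_mem_faceWeights hc hls)),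
    reweight_inv_reweight hc hls.1]

/-- Compactness of the weight space makes the passage from points to weights continuous on all of
`K` at once, with no gluing over faces. -/
theorem continuousOn_rescale [TopologicalSpace E] [T2Space E] [ContinuousAdd E]
    [ContinuousSMul ℝ E] (hK : K.faces.Finite) (hX : K.vertices = (X : Set E)) {c : X → ℝ}
    (hc : ∀ i, 0 < c i) : ContinuousOn (K.rescale c) K.space := by
  have hcont : Continuous (weightedSum : (X → ℝ) → E) := by
    unfold weightedSum
    fun_prop
  have h₁ := (isCompact_weights hK).continuousOn_invFunOn hcont.continuousOn
    (weightedSum_injOn_weights hX)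
  rw [weightedSum_image_weights hX] at h₁
  refine hcont.comp_continuousOn ((continuousOn_reweight hc).comp h₁ fun p hp => ?_)
  rw [← weightedSum_image_weights hX] at hp
  exact weights_subset_stdSimplex (Function.invFunOn_mem hp)

end Geometry.SimplicialComplex

/-! ### Rescaling of sublevel sets and its definability -/

section Sublevel

variable {d : ℕ} {K : Geometry.SimplicialComplex ℝ (EuclideanSpace ℝ (Fin d))}
  {X : Finset (EuclideanSpace ℝ (Fin d))} {v w : EuclideanSpace ℝ (Fin d)} {t t' : ℝ}

/-- The weights `c` multiply the signed heights in direction `w` over the level `t'` to those in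
direction `v` over the level `t`. -/
def IsLevelRatio (X : Finset (EuclideanSpace ℝ (Fin d))) (v w : EuclideanSpace ℝ (Fin d))
    (t t' : ℝ) (c : X → ℝ) : Prop :=
  ∀ i : X, 0 < c i ∧ c i * (⟪w, (i : EuclideanSpace ℝ (Fin d))⟫ - t') =
    ⟪v, (i : EuclideanSpace ℝ (Fin d))⟫ - t

/-- Strict monotonicity gives `a - t` and `φ a - φ t` the same sign, so their quotient is positive;
for `a = t` both vanish and any positive factor, here `1`, will do. -/
theorem exists_isLevelRatio {φ : ℝ ≃o ℝ} (hφ : ∀ x ∈ X, φ ⟪v, x⟫ = ⟪w, x⟫) (t : ℝ) :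
    ∃ c, IsLevelRatio X v w t (φ t) c := by
  have key : ∀ a : ℝ, ∃ r : ℝ, 0 < r ∧ r * (φ a - φ t) = a - t := by
    intro a
    rcases lt_trichotomy a t with h | rfl | h
    · have h' := sub_neg.2 (φ.strictMono h)
      exact ⟨_, div_pos_of_neg_of_neg (sub_neg.2 h) h', div_mul_cancel₀ _ h'.ne⟩
    · exact ⟨1, one_pos, by simp⟩
    · have h' := sub_pos.2 (φ.strictMono h)
      exact ⟨_, div_pos (sub_pos.2 h) h', div_mul_cancel₀ _ h'.ne'⟩
  choose r hr using key
  exact ⟨fun i => r ⟪v, (i : EuclideanSpace ℝ (Fin d))⟫, fun i => by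
    rw [← hφ i i.2]; exact hr _⟩

theorem IsLevelRatio.inv {c : X → ℝ} (hc : IsLevelRatio X v w t t' c) :
    IsLevelRatio X w v t' t c⁻¹ := fun i =>
  ⟨inv_pos.2 (hc i).1, by rw [Pi.inv_apply, ← (hc i).2, inv_mul_cancel_left₀ (hc i).1.ne']⟩

theorem inner_weightedSum (v : EuclideanSpace ℝ (Fin d)) (l : X → ℝ) :
    ⟪v, weightedSum l⟫ = ∑ i, l i * ⟪v, (i : EuclideanSpace ℝ (Fin d))⟫ := by
  simp only [weightedSum, inner_sum, real_inner_smul_right]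

theorem weightedSum_apply (l : X → ℝ) (j : Fin d) :
    weightedSum l j = ∑ i, l i * (i : EuclideanSpace ℝ (Fin d)) j := by
  simp [weightedSum]

theorem inner_weightedSum_sub {l : X → ℝ} (hl : l ∈ stdSimplex ℝ X) :
    ⟪v, weightedSum l⟫ - t = ∑ i, l i * (⟪v, (i : EuclideanSpace ℝ (Fin d))⟫ - t) := by
  simp only [inner_weightedSum, mul_sub, Finset.sum_sub_distrib, ← Finset.sum_mul, hl.2, one_mul]

/-- The signed height of the image over `t'` is that of `p` over `t` divided by the mass, so its
sign is unchanged. -/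
theorem IsLevelRatio.rescale_mem_sublevel (hX : K.vertices = (X : Set _)) {c : X → ℝ}
    (hc : IsLevelRatio X v w t t' c) {p : EuclideanSpace ℝ (Fin d)}
    (hp : p ∈ sublevel K.space v t) : K.rescale c p ∈ sublevel K.space w t' := by
  obtain ⟨hpK, hpt⟩ := hp
  obtain ⟨s, hs, hps⟩ := K.mem_space_iff.1 hpK
  have hc0 := fun i => (hc i).1
  refine ⟨K.mem_space_iff.2 ⟨s, hs, K.rescale_mem_convexHull hX hc0 hs hps⟩, ?_⟩
  rw [← weightedSum_image_faceWeights (K.face_subset_of_vertices_eq hX hs)] at hps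
  obtain ⟨l, hl, rfl⟩ := hps
  rw [K.rescale_weightedSum hX c (mem_biUnion hs hl), ← sub_nonpos,
    inner_weightedSum_sub (reweight_mem_faceWeights hc0 hl).1]
  rw [← sub_nonpos, inner_weightedSum_sub hl.1] at hpt
  have : ∀ i : X, reweight c l i * (⟪w, (i : EuclideanSpace ℝ (Fin d))⟫ - t') =
      l i * (⟪v, (i : EuclideanSpace ℝ (Fin d))⟫ - t) / ∑ j, c j * l j := fun i => by
    rw [← (hc i).2, reweight]
    ring
  simp only [this]
  rw [← Finset.sum_div]
  exact div_nonpos_of_nonpos_of_nonneg hpt (mass_pos hc0 hl.1).le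

theorem IsLevelRatio.bijOn_rescale (hX : K.vertices = (X : Set _)) {c : X → ℝ}
    (hc : IsLevelRatio X v w t t' c) :
    BijOn (K.rescale c) (sublevel K.space v t) (sublevel K.space w t') := by
  refine InvOn.bijOn (f' := K.rescale c⁻¹) ⟨fun p hp => ?_, fun p hp => ?_⟩
    (fun p hp => hc.rescale_mem_sublevel hX hp) (fun p hp => hc.inv.rescale_mem_sublevel hX hp)
  · exact K.rescale_inv_rescale hX (fun i => (hc i).1) hp.1
  · have := K.rescale_inv_rescale hX (fun i => (hc.inv i).1) hp.1
    rwa [inv_inv] at this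

/-- The graph of the rescaling map over the part of a simplex below level `t` is definable; the
barycentric coordinates are written as squares `y i ^ 2`, and `y none ^ 2` is the distance to the
level. -/
theorem OMinimalStructure.rescaledFace_mem (O : OMinimalStructure)
    (s : Finset (EuclideanSpace ℝ (Fin d))) (v : EuclideanSpace ℝ (Fin d)) (t : ℝ) (c : X → ℝ) :
    {p : Fin (d + d) → ℝ | ∃ y : Option X → ℝ,
      (∑ i : X, y i ^ 2 = 1 ∧
        ∑ i : X, ⟪v, (i : EuclideanSpace ℝ (Fin d))⟫ * y i ^ 2 + y none ^ 2 = t) ∧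
      (∀ i : X, (i : EuclideanSpace ℝ (Fin d)) ∉ s → y i = 0) ∧
      (∀ j, ∑ i : X, y i ^ 2 * (i : EuclideanSpace ℝ (Fin d)) j = p (Fin.castAdd d j)) ∧
      ∀ j, ∑ i : X, c i * y i ^ 2 * (i : EuclideanSpace ℝ (Fin d)) j =
        p (Fin.natAdd d j) * ∑ i : X, c i * y i ^ 2} ∈ O.sets (d + d) := by
  -- All conditions are polynomial: the equation for the image point has its denominator, the mass
  -- `∑ c i * y i ^ 2`, cleared.
  let V : Option X → MvPolynomial (Fin (d + d) ⊕ Option X) ℝ := fun i => .X (.inr i)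
  convert O.exists_eval_eq_zero_mem (
    ({∑ i : X, V i ^ 2 - 1,
      ∑ i : X, .C ⟪v, (i : EuclideanSpace ℝ (Fin d))⟫ * V i ^ 2 + V none ^ 2 - .C t} :
        Set (MvPolynomial (Fin (d + d) ⊕ Option X) ℝ)) ∪
    (range (fun i : {i : X // (i : EuclideanSpace ℝ (Fin d)) ∉ s} => V i.1) ∪
    (range (fun j : Fin d => ∑ i : X, V i ^ 2 * .C ((i : EuclideanSpace ℝ (Fin d)) j) -
      .X (.inl (Fin.castAdd d j))) ∪
    range (fun j : Fin d => ∑ i : X, .C (c i) * V i ^ 2 * .C ((i : EuclideanSpace ℝ (Fin d)) j) -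
      .X (.inl (Fin.natAdd d j)) * ∑ i : X, .C (c i) * V i ^ 2)))) using 1
  ext p
  simp only [mem_ofPred_eq, V, mem_union, mem_insert_iff, mem_singleton_iff, or_imp,
    forall_and, forall_eq, mem_range, forall_exists_index, forall_apply_eq_imp_iff,
    map_sub, map_sum, map_add, map_mul, map_pow, MvPolynomial.eval_X, MvPolynomial.eval_C,
    Sum.elim_inl, Sum.elim_inr, map_one, sub_eq_zero]
  simp only [Subtype.forall]

/-- The graph is the union of its pieces over the finitely many faces, with the barycentric
coordinates quantified existentially. -/
theorem IsLevelRatio.isDefinableBijection_rescale (O : OMinimalStructure) (hK : K.faces.Finite)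
    (hX : K.vertices = (X : Set _)) {c : X → ℝ} (hc : IsLevelRatio X v w t t' c) :
    O.IsDefinableBijection (fun x => WithLp.ofLp (K.rescale c (WithLp.toLp 2 x)))
      (sublevelCoord K.space v t) (sublevelCoord K.space w t') := by
  have hc0 := fun i => (hc i).1
  refine ⟨?_, ?_⟩
  · have hb := hc.bijOn_rescale hX
    refine ⟨?_, ?_, ?_⟩
    · rintro _ ⟨p, hp, rfl⟩
      exact ⟨_, hb.mapsTo hp, rfl⟩
    · rintro _ ⟨p, hp, rfl⟩ _ ⟨q, hq, rfl⟩ h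
      exact congrArg _ (hb.injOn hp hq (WithLp.ofLp_injective 2 h))
    · rintro _ ⟨p, hp, rfl⟩
      obtain ⟨q, hq, rfl⟩ := hb.surjOn hp
      exact ⟨_, ⟨q, hq, rfl⟩, rfl⟩
  · convert O.biUnion_mem hK fun s _ => O.rescaledFace_mem s v t c using 1
    ext p
    simp only [mem_iUnion, exists_prop, mem_ofPred_eq]
    constructor
    · rintro ⟨_, ⟨q, ⟨hqK, hqt⟩, rfl⟩, rfl⟩
      obtain ⟨s, hs, hqs⟩ := K.mem_space_iff.1 hqK
      rw [← weightedSum_image_faceWeights (K.face_subset_of_vertices_eq hX hs)] at hqs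
      obtain ⟨l, hl, rfl⟩ := hqs
      rw [inner_weightedSum] at hqt
      have hsq : ∀ i, √(l i) ^ 2 = l i := fun i => Real.sq_sqrt (hl.1.1 i)
      refine ⟨s, hs, fun o => o.elim (√(t - ∑ i, l i * ⟪v, (i : EuclideanSpace ℝ (Fin d))⟫))
        fun i => √(l i), ⟨?_, ?_⟩, fun i hi => ?_, fun j => ?_, fun j => ?_⟩
      · simpa only [Option.elim, hsq] using hl.1.2
      · simp only [Option.elim, hsq]
        rw [Real.sq_sqrt (sub_nonneg.2 hqt)]
        simp only [mul_comm (l _), add_sub_cancel]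
      · simp only [Option.elim, hl.2 i hi, Real.sqrt_zero]
      · simp only [Option.elim, hsq, Fin.append_left, weightedSum_apply]
      · simp only [Option.elim, hsq, Fin.append_right, WithLp.toLp_ofLp]
        rw [K.rescale_weightedSum hX c (mem_biUnion hs hl), weightedSum_apply, Finset.sum_mul]
        refine Finset.sum_congr rfl fun i _ => ?_
        have := (mass_pos hc0 hl.1).ne'
        rw [reweight]
        field_simp
    · rintro ⟨s, hs, y, ⟨h₁, h₂⟩, h₃, h₄, h₅⟩
      have hl : (fun i : X => y i ^ 2) ∈ faceWeights X s :=
        ⟨⟨fun i => sq_nonneg _, h₁⟩, fun i hi => by simp [h₃ i hi]⟩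
      have hlK := mem_biUnion hs hl
      refine ⟨_, ⟨weightedSum fun i : X => y i ^ 2, ⟨?_, ?_⟩, rfl⟩, ?_⟩
      · exact K.weightedSum_image_weights hX ▸ mem_image_of_mem _ hlK
      · rw [inner_weightedSum, ← h₂]
        simp only [mul_comm (y _ ^ 2)]
        exact le_add_of_nonneg_right (sq_nonneg _)
      · ext j
        refine Fin.addCases (fun j => ?_) (fun j => ?_) j
        · rw [Fin.append_left, weightedSum_apply, h₄]
        · have hm := (mass_pos hc0 hl.1).ne'
          rw [Fin.append_right, WithLp.toLp_ofLp, K.rescale_weightedSum hX c hlK,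
            weightedSum_apply, ← mul_left_inj' hm, ← h₅, Finset.sum_mul]
          refine Finset.sum_congr rfl fun i _ => ?_
          rw [reweight]
          field_simp

end Sublevel

/-! ### Uniqueness of persistence diagrams -/

/-- Take `s` between `b` and the least element of `C` above `b`; adding `d` to the candidates forces
`s < d`. -/
theorem exists_real_btwn_of_finset {b d : EReal} (h : b < d) (C : Finset EReal) :
    ∃ s : ℝ, b < s ∧ (s : EReal) < d ∧ (∀ c ∈ C, c ≤ s → c ≤ b) := by
  let D := insert d (C.filter (b < ·))
  have hD : D.Nonempty := ⟨d, Finset.mem_insert_self _ _⟩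
  have hb : b < D.min' hD := by
    rw [Finset.lt_min'_iff]
    intro c hc
    rcases Finset.mem_insert.1 hc with rfl | hc
    · exact h
    · exact (Finset.mem_filter.1 hc).2
  obtain ⟨s, hbs, hs⟩ := EReal.lt_iff_exists_real_btwn.1 hb
  refine ⟨s, hbs, hs.trans_le (D.min'_le _ (Finset.mem_insert_self _ _)), fun c hc hcs => ?_⟩
  by_contra! hbc
  exact (hs.trans_le (D.min'_le c (by simp [D, hc, hbc]))).not_ge hcs

theorem exists_real_btwn_of_finset' {b d : EReal} (h : b < d) (C : Finset EReal) :
    ∃ s : ℝ, b < s ∧ (s : EReal) < d ∧ (∀ c ∈ C, (s : EReal) < c → d ≤ c) := by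
  obtain ⟨s, h₁, h₂, h₃⟩ := exists_real_btwn_of_finset (EReal.neg_lt_neg_iff.2 h)
    (C.image (- ·))
  refine ⟨-s, ?_, ?_, fun c hc hs => ?_⟩
  · rw [EReal.coe_neg]; exact EReal.lt_neg_comm.1 h₂
  · rw [EReal.coe_neg]; exact EReal.neg_lt_comm.1 h₁
  · rw [EReal.coe_neg] at hs
    exact EReal.neg_le_neg_iff.1 (h₃ _ (Finset.mem_image_of_mem _ hc) (EReal.neg_lt_comm.1 hs).le)

open Classical in
/-- A finite multiset of points above the diagonal is determined by its counts in the quadrants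
`[-∞, s] × (t, ∞]` with `s ≤ t`. -/
theorem multiset_eq_of_quadrant_counts {D D' : Multiset (EReal × EReal)}
    (hD : ∀ p ∈ D, p.1 < p.2) (hD' : ∀ p ∈ D', p.1 < p.2)
    (h : ∀ s t : ℝ, s ≤ t → (D.filter fun p => p.1 ≤ (s : EReal) ∧ (t : EReal) < p.2).card =
      (D'.filter fun p => p.1 ≤ (s : EReal) ∧ (t : EReal) < p.2).card) : D = D' := by
  induction hn : D.card using Nat.strong_induction_on generalizing D D' with
  | _ n ih =>
  by_cases hne : (D + D').toFinset.Nonempty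
  swap
  · rw [Finset.not_nonempty_iff_eq_empty, Multiset.toFinset_eq_empty, add_eq_zero] at hne
    rw [hne.1, hne.2]
  -- Choose the earliest birth and, among those, the latest death. A quadrant with corner just after
  -- this birth and just before this death then contains no other point.
  obtain ⟨p, hp, hmin⟩ := Finset.exists_min_image (D + D').toFinset
    (fun p => toLex (p.1, OrderDual.toDual p.2)) hne
  have hlt : p.1 < p.2 := by
    rcases Multiset.mem_add.1 (Multiset.mem_toFinset.1 hp) with hp | hp
    exacts [hD p hp, hD' p hp]
  obtain ⟨s, hs, hsp, hsC⟩ := exists_real_btwn_of_finset hlt ((D + D').toFinset.image Prod.fst)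
  -- Choosing `t` between `s` and the death, rather than between birth and death, ensures `s ≤ t`.
  obtain ⟨t, ht, htp, htC⟩ := exists_real_btwn_of_finset' hsp ((D + D').toFinset.image Prod.snd)
  have hst : s ≤ t := by exact_mod_cast ht.le
  have key : ∀ q ∈ (D + D').toFinset, (q.1 ≤ (s : EReal) ∧ (t : EReal) < q.2) ↔ q = p := by
    intro q hq
    refine ⟨fun ⟨h₁, h₂⟩ => ?_, fun h => h ▸ ⟨hs.le, htp⟩⟩
    have h₁ := hsC _ (Finset.mem_image_of_mem _ hq) h₁
    have h₂ := htC _ (Finset.mem_image_of_mem _ hq) h₂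
    rcases Prod.Lex.toLex_le_toLex.1 (hmin q hq) with h₃ | ⟨h₃, h₄⟩
    · exact absurd h₁ h₃.not_ge
    · exact Prod.ext h₃.symm (le_antisymm (OrderDual.toDual_le_toDual.1 h₄) h₂)
  have hcount : ∀ E : Multiset (EReal × EReal), E ≤ D + D' →
      (E.filter fun p => p.1 ≤ (s : EReal) ∧ (t : EReal) < p.2).card = E.count p := by
    intro E hE
    rw [← Multiset.countP_eq_card_filter, Multiset.count]
    refine Multiset.countP_congr rfl fun q hq => ?_
    rw [key q (Multiset.mem_toFinset.2 (Multiset.mem_of_le hE hq))]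
    exact propext eq_comm
  have hc : D.count p = D'.count p := by
    rw [← hcount D (Multiset.le_add_right _ _), ← hcount D' (Multiset.le_add_left _ _), h s t hst]
  have hmem : p ∈ D ∧ p ∈ D' := by
    have := Multiset.mem_add.1 (Multiset.mem_toFinset.1 hp)
    rw [← Multiset.one_le_count_iff_mem, ← Multiset.one_le_count_iff_mem, ← hc] at this ⊢
    exact ⟨by tauto, by tauto⟩
  -- Equal multiplicities put `p` in both multisets; cancel one copy from each and induct.
  obtain ⟨E, rfl⟩ := Multiset.exists_cons_of_mem hmem.1
  obtain ⟨E', rfl⟩ := Multiset.exists_cons_of_mem hmem.2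
  congr 1
  refine ih E.card (by simp [← hn]) (fun q hq => hD q (Multiset.mem_cons_of_mem hq))
    (fun q hq => hD' q (Multiset.mem_cons_of_mem hq)) (fun a b hab => ?_) rfl
  have := h a b hab
  simp only [Multiset.filter_cons] at this
  simpa using this

/-! ### Order isomorphisms of the line and chambers -/

theorem extendEReal_strictMono {φ : ℝ → ℝ} (hφ : StrictMono φ) : StrictMono (extendEReal φ) :=
  hφ.withTop_map.withBot_map

theorem extendEReal_coe (φ : ℝ → ℝ) (t : ℝ) : extendEReal φ t = (φ t : ℝ) := rfl

/-- The order isomorphism of the line that fixes `(-∞, c]` and has slope `r` on `[c, ∞)`. -/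
def stretchAbove (c r : ℝ) (hr : 0 < r) : ℝ ≃o ℝ :=
  StrictMono.orderIsoOfRightInverse (fun y => if y ≤ c then y else c + r * (y - c))
    (by
      intro x y hxy
      dsimp only
      split_ifs with h₁ h₂ h₂
      · exact hxy
      · have := mul_pos hr (sub_pos.2 (not_le.1 h₂)); linarith
      · linarith
      · have := mul_lt_mul_of_pos_left hxy hr; linarith)
    (fun y => if y ≤ c then y else c + r⁻¹ * (y - c))
    (by
      intro y
      dsimp only
      by_cases h : y ≤ c
      · simp [h]
      · have h₂ : ¬ c + r⁻¹ * (y - c) ≤ c := by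
          have := mul_pos (inv_pos.2 hr) (sub_pos.2 (not_le.1 h)); linarith
        rw [if_neg h, if_neg h₂]
        field_simp
        ring)

/-- A strictly monotone map on a finite set of reals extends to an order isomorphism. -/
theorem exists_orderIso_extending (A : Finset ℝ) (f : ℝ → ℝ)
    (hf : StrictMonoOn f (A : Set ℝ)) : ∃ φ : ℝ ≃o ℝ, ∀ a ∈ A, φ a = f a := by
  induction A using Finset.induction_on_max with
  | empty => exact ⟨OrderIso.refl ℝ, by simp⟩
  | insert a A ha ih =>
    obtain ⟨φ, hφ⟩ := ih (hf.mono (by simp))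
    rcases A.eq_empty_or_nonempty with rfl | hA
    · exact ⟨OrderIso.addRight (f a - a), by simp⟩
    let c := A.max' hA
    have hc : c ∈ A := A.max'_mem hA
    have h₁ : φ c < φ a := φ.strictMono (ha c hc)
    have h₂ : f c < f a := hf (by simp [hc]) (by simp) (ha c hc)
    rw [← hφ c hc] at h₂
    -- Stretching above `φ c` leaves the values on `A` alone, and the slope is the one that moves `φ
    -- a` to `f a`.
    refine ⟨φ.trans (stretchAbove (φ c) ((f a - φ c) / (φ a - φ c))
      (div_pos (sub_pos.2 h₂) (sub_pos.2 h₁))), fun x hx => ?_⟩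
    change (if φ x ≤ φ c then φ x else φ c + _ * (φ x - φ c)) = f x
    rcases Finset.mem_insert.1 hx with rfl | hx
    · rw [if_neg h₁.not_ge, div_mul_cancel₀ _ (sub_pos.2 h₁).ne']
      ring
    · rw [if_pos (φ.monotone (A.le_max' x hx)), hφ x hx]

/-- Within a chamber the order of the heights of the points of `X` does not change. -/
theorem SameChamber.inner_lt_inner {d : ℕ} {X : Set (EuclideanSpace ℝ (Fin d))}
    {v w : EuclideanSpace ℝ (Fin d)} (h : SameChamber X v w) {x y : EuclideanSpace ℝ (Fin d)}
    (hx : x ∈ X) (hy : y ∈ X) (hxy : ⟪v, x⟫ < ⟪v, y⟫) : ⟪w, x⟫ < ⟪w, y⟫ := by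
  by_contra! hle
  have hne : x ≠ y := by rintro rfl; exact lt_irrefl _ hxy
  -- If the order were reversed at `w`, the two heights would agree at some `u` in the component,
  -- which would lie in `W(X)`.
  obtain ⟨u, hu, h0⟩ := (isPreconnected_connectedComponentIn
    (x := v) (F := sphereComplement X)).intermediate_value₂
    (mem_connectedComponentIn h.1) h.2 (f := fun u => ⟪u, x⟫) (g := fun u => ⟪u, y⟫)
    (by fun_prop) (by fun_prop) hxy.le hle
  refine (connectedComponentIn_subset _ _ hu).2 ⟨x, hx, y, hy, hne, ?_⟩
  rw [real_inner_comm, real_inner_comm u y]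
  exact h0

theorem SameChamber.inner_injOn {d : ℕ} {X : Set (EuclideanSpace ℝ (Fin d))}
    {v w : EuclideanSpace ℝ (Fin d)} (h : SameChamber X v w) :
    InjOn (fun x => ⟪v, x⟫) X := by
  intro x hx y hy hxy
  by_contra hne
  refine h.1.2 ⟨x, hx, y, hy, hne, ?_⟩
  rw [real_inner_comm, real_inner_comm v y]
  exact hxy

theorem SameChamber.exists_orderIso {d : ℕ} {X : Finset (EuclideanSpace ℝ (Fin d))}
    {v w : EuclideanSpace ℝ (Fin d)} (h : SameChamber (X : Set (EuclideanSpace ℝ (Fin d))) v w) :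
    ∃ φ : ℝ ≃o ℝ, ∀ x ∈ X, φ ⟪v, x⟫ = ⟪w, x⟫ := by
  classical
  have hinv := h.inner_injOn.leftInvOn_invFunOn
  -- Heights in direction `v` are distinct on `X`, so the height in direction `w` is a function of
  -- them.
  obtain ⟨φ, hφ⟩ := exists_orderIso_extending (X.image fun x => ⟪v, x⟫)
    (fun a => ⟪w, Function.invFunOn (fun x => ⟪v, x⟫) (X : Set (EuclideanSpace ℝ (Fin d))) a⟫) (by
      intro a ha b hb hab
      simp only [Finset.coe_image, mem_image] at ha hb
      obtain ⟨x, hx, rfl⟩ := ha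
      obtain ⟨y, hy, rfl⟩ := hb
      simp only [hinv hx, hinv hy]
      exact h.inner_lt_inner hx hy hab)
  refine ⟨φ, fun x hx => ?_⟩
  rw [hφ _ (Finset.mem_image_of_mem _ hx)]
  exact congrArg (fun z => ⟪w, z⟫) (hinv hx)

/-! ### Comparison of persistence ranks -/

section Persistence

variable {d : ℕ} {K : Geometry.SimplicialComplex ℝ (EuclideanSpace ℝ (Fin d))}
  {X : Finset (EuclideanSpace ℝ (Fin d))} {v w : EuclideanSpace ℝ (Fin d)} {t t' : ℝ}

/-- The map of sublevel sets given by rescaling barycentric coordinates. -/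
def IsLevelRatio.sublevelMap (hK : K.faces.Finite) (hX : K.vertices = (X : Set _)) {c : X → ℝ}
    (hc : IsLevelRatio X v w t t' c) :
    TopCat.of (sublevel K.space v t) ⟶ TopCat.of (sublevel K.space w t') :=
  TopCat.ofHom ⟨MapsTo.restrict (K.rescale c) _ _ fun _ hp => hc.rescale_mem_sublevel hX hp,
    ((K.continuousOn_rescale hK hX fun i => (hc i).1).mono fun _ hp => hp.1).mapsToRestrict _⟩

/-- Two maps into a sublevel set of `K` such that the images of each point lie in a common
simplex are homotopic along straight lines. -/
theorem nonempty_homotopy_of_common_face {Y : TopCat.{0}}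
    {f g : Y ⟶ TopCat.of (sublevel K.space w t)}
    (h : ∀ y, ∃ s ∈ K.faces, ((f y : sublevel K.space w t) : EuclideanSpace ℝ (Fin d)) ∈
      convexHull ℝ (s : Set (EuclideanSpace ℝ (Fin d))) ∧
      ((g y : sublevel K.space w t) : EuclideanSpace ℝ (Fin d)) ∈
        convexHull ℝ (s : Set (EuclideanSpace ℝ (Fin d)))) :
    Nonempty (TopCat.Homotopy f g) := by
  let F (p : unitInterval × Y) : EuclideanSpace ℝ (Fin d) :=
    AffineMap.lineMap ((f p.2 : sublevel K.space w t) : EuclideanSpace ℝ (Fin d))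
      ((g p.2 : sublevel K.space w t) : EuclideanSpace ℝ (Fin d)) (p.1 : ℝ)
  have hf : Continuous fun y : Y => ((f y : sublevel K.space w t) : EuclideanSpace ℝ (Fin d)) :=
    continuous_subtype_val.comp f.hom.continuous
  have hg : Continuous fun y : Y => ((g y : sublevel K.space w t) : EuclideanSpace ℝ (Fin d)) :=
    continuous_subtype_val.comp g.hom.continuous
  have hF : Continuous F := by
    simp only [F, AffineMap.lineMap_apply_module]
    have h₁ := hf.comp (continuous_snd (X := unitInterval))
    have h₂ := hg.comp (continuous_snd (X := unitInterval))
    have h₃ : Continuous fun p : unitInterval × Y => (p.1 : ℝ) :=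
      continuous_subtype_val.comp continuous_fst
    exact ((continuous_const.sub h₃).smul h₁).add (h₃.smul h₂)
  have hmem : ∀ p, F p ∈ sublevel K.space w t := by
    rintro ⟨r, y⟩
    obtain ⟨s, hs, hfs, hgs⟩ := h y
    refine ⟨K.mem_space_iff.2 ⟨s, hs, (convex_convexHull ℝ _).lineMap_mem hfs hgs r.2⟩, ?_⟩
    exact (convex_halfSpace_le (innerₛₗ ℝ w).isLinear t).lineMap_mem
      (f y : sublevel K.space w t).2.2 (g y : sublevel K.space w t).2.2 r.2
  exact ⟨{ toFun := fun p => ⟨F p, hmem p⟩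
           continuous_toFun := hF.subtype_mk hmem
           map_zero_left := fun y => Subtype.ext (AffineMap.lineMap_apply_zero _ _)
           map_one_left := fun y => Subtype.ext (AffineMap.lineMap_apply_one _ _) }⟩

/-- On homology the `w`-inclusion factors through the `v`-inclusion, and a factorisation bounds the
rank. The reverse bound follows by applying this to `φ.symm`. -/
theorem rank_persistenceMap_le (F : Type u) [Field F] (hK : K.faces.Finite)
    (hX : K.vertices = (X : Set _)) {φ : ℝ ≃o ℝ} (hφ : ∀ x ∈ X, φ ⟪v, x⟫ = ⟪w, x⟫) (k : ℕ)
    {s t : ℝ} (h : s ≤ t) (h' : φ s ≤ φ t) :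
    (persistenceMap F K.space w k h').rank ≤ (persistenceMap F K.space v k h).rank := by
  obtain ⟨c, hc⟩ := exists_isLevelRatio hφ s
  obtain ⟨c', hc'⟩ := exists_isLevelRatio hφ t
  let f := hc.inv.sublevelMap hK hX
  let g := hc'.sublevelMap hK hX
  obtain ⟨H⟩ : Nonempty (TopCat.Homotopy (sublevelIncl K.space w h')
      (f ≫ sublevelIncl K.space v h ≫ g)) := by
    refine nonempty_homotopy_of_common_face fun y => ?_
    -- Rescaling with either set of factors stays in any face containing `y`, so `y` and its image
    -- share `σ`.
    obtain ⟨σ, hσ, hy⟩ := K.mem_space_iff.1 y.2.1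
    exact ⟨σ, hσ, hy, K.rescale_mem_convexHull hX (fun i => (hc' i).1) hσ
      (K.rescale_mem_convexHull hX (fun i => (hc.inv i).1) hσ hy)⟩
  have key := H.congr_homologyMap_singularChainComplexFunctor (ModuleCat.of F F) k
  have key' : persistenceMap F K.space w k h' =
      (((AlgebraicTopology.singularHomologyFunctor (ModuleCat.{u} F) k).obj
        (ModuleCat.of F F)).map (f ≫ sublevelIncl K.space v h ≫ g)).hom :=
    congrArg ModuleCat.Hom.hom key
  rw [key', Functor.map_comp, Functor.map_comp, ModuleCat.hom_comp, ModuleCat.hom_comp]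
  exact (LinearMap.rank_comp_le_left _ _).trans (LinearMap.rank_comp_le_right _ _)

theorem rank_persistenceMap_eq (F : Type u) [Field F] (hK : K.faces.Finite)
    (hX : K.vertices = (X : Set _)) {φ : ℝ ≃o ℝ} (hφ : ∀ x ∈ X, φ ⟪v, x⟫ = ⟪w, x⟫) (k : ℕ)
    {s t : ℝ} (h : s ≤ t) (h' : φ s ≤ φ t) :
    (persistenceMap F K.space w k h').rank = (persistenceMap F K.space v k h).rank := by
  refine le_antisymm (rank_persistenceMap_le F hK hX hφ k h h') ?_
  have hφ' : ∀ x ∈ X, φ.symm ⟪w, x⟫ = ⟪v, x⟫ := fun x hx => by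
    rw [← hφ x hx, φ.symm_apply_apply]
  -- The spaces depend on the levels, so `φ.symm (φ s) = s` has to be used by substitution.
  have hs : ∀ {a b : ℝ} (_ : a = s) (_ : b = t) (hab : a ≤ b),
      (persistenceMap F K.space v k hab).rank = (persistenceMap F K.space v k h).rank := by
    rintro _ _ rfl rfl _
    rfl
  rw [← hs (φ.symm_apply_apply s) (φ.symm_apply_apply t) (φ.symm.monotone h')]
  exact rank_persistenceMap_le F hK hX hφ' k h' _

theorem IsPersistenceDiagram.unique {F : Type u} [Field F] {M : Set (EuclideanSpace ℝ (Fin d))}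
    {k : ℕ} {D D' : Multiset (EReal × EReal)} (hD : IsPersistenceDiagram F M v k D)
    (hD' : IsPersistenceDiagram F M v k D') : D = D' :=
  multiset_eq_of_quadrant_counts hD.1 hD'.1 fun s t h => by
    have := (hD.2 s t h).symm.trans (hD'.2 s t h)
    exact_mod_cast this

theorem IsPersistenceDiagram.map_extendEReal {F : Type u} [Field F] (hK : K.faces.Finite)
    (hX : K.vertices = (X : Set _)) {φ : ℝ ≃o ℝ} (hφ : ∀ x ∈ X, φ ⟪v, x⟫ = ⟪w, x⟫) {k : ℕ}
    {D : Multiset (EReal × EReal)} (hD : IsPersistenceDiagram F K.space v k D) :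
    IsPersistenceDiagram F K.space w k (D.map (Prod.map (extendEReal φ) (extendEReal φ))) := by
  classical
  have hmono := extendEReal_strictMono φ.strictMono
  refine ⟨fun p hp => ?_, fun s t h => ?_⟩
  · obtain ⟨q, hq, rfl⟩ := Multiset.mem_map.1 hp
    exact hmono (hD.1 q hq)
  · obtain ⟨s, rfl⟩ := φ.surjective s
    obtain ⟨t, rfl⟩ := φ.surjective t
    rw [rank_persistenceMap_eq F hK hX hφ k (φ.le_iff_le.1 h) h, hD.2, Multiset.filter_map,
      Multiset.card_map]
    congr 3
    ext p
    simp only [Function.comp, Prod.map_fst, Prod.map_snd, ← extendEReal_coe, hmono.le_iff_le,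
      hmono.lt_iff_lt]

end Persistence

end

theorem proposition4 (O : OMinimalStructure) (F : Type u) [Field F] {d : ℕ}
    (X : Finset (EuclideanSpace ℝ (Fin d))) (v w : EuclideanSpace ℝ (Fin d))
    (hvw : SameChamber (X : Set (EuclideanSpace ℝ (Fin d))) v w) :
    -- an order isomorphism of the line matching the heights of the points of `X` exists,
    (∃ φ : ℝ ≃o ℝ, ∀ x ∈ X, φ ⟪v, x⟫ = ⟪w, x⟫) ∧
    -- and each of them transforms the invariants of every finite complex with vertex set `X`
    ∀ φ : ℝ ≃o ℝ, (∀ x ∈ X, φ ⟪v, x⟫ = ⟪w, x⟫) →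
      ∀ K : Geometry.SimplicialComplex ℝ (EuclideanSpace ℝ (Fin d)),
        K.faces.Finite → K.vertices = (X : Set (EuclideanSpace ℝ (Fin d))) →
        ((∀ (t : ℝ) (m : ℤ), O.IsEulerChar (sublevelCoord K.space w (φ t)) m ↔
            O.IsEulerChar (sublevelCoord K.space v t) m) ∧
          eulerCurve O K.space w = eulerCurve O K.space v ∘ φ.symm) ∧
        ∀ (k : ℕ) (D : Multiset (EReal × EReal)), IsPersistenceDiagram F K.space v k D →
          ∀ D' : Multiset (EReal × EReal), IsPersistenceDiagram F K.space w k D' ↔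
            D' = D.map (Prod.map (extendEReal φ) (extendEReal φ)) := by
  refine ⟨hvw.exists_orderIso, fun φ hφ K hK hX => ?_⟩
  have hEuler : ∀ (t : ℝ) (m : ℤ), O.IsEulerChar (sublevelCoord K.space w (φ t)) m ↔
      O.IsEulerChar (sublevelCoord K.space v t) m := fun t m => by
    obtain ⟨c, hc⟩ := exists_isLevelRatio hφ t
    exact ⟨(hc.isDefinableBijection_rescale O hK hX).isEulerChar,
      (hc.inv.isDefinableBijection_rescale O hK hX).isEulerChar⟩
  refine ⟨⟨hEuler, funext fun τ => ?_⟩, fun k D hD D' =>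
    ⟨fun hD' => hD'.unique (hD.map_extendEReal hK hX hφ), ?_⟩⟩
  · obtain ⟨t, rfl⟩ := φ.surjective τ
    simp only [Function.comp, φ.symm_apply_apply, eulerCurve]
    exact OMinimalStructure.eulerChar_congr (hEuler t)
  · rintro rfl
    exact hD.map_extendEReal hK hX hφ
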